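/- **Theorem (Hamilton equations).** Let $T,m,c>0$, let $\phi:[0,T]\to(0,\infty)$ be smooth, let $f:\mathbb R^n\times\mathbb R^N\times[0,T]\to\mathbb R^n$, $(\xi,u,t)\mapsto f(\xi,u,t)$, and $\ell:\mathbb R^N\times\mathbb R^n\times[0,T]\to[0,\infty)$, $(u,\xi,t)\mapsto \ell(u,\xi,t)$, be continuous, differentiable in $(\xi,u)$ for each $t$, with derivative in $(\xi,u)$ continuous in all variables; let $x^0\in\mathbb R^n$, $w^0\in\mathbb R^N$. Call a measurable, integrable control $v:[0,T]\to\mathbb R^N$ admissible, with trajectory $(x,w)$, if $w(t)=w^0+\int_0^t v(s)\,ds$ (that is, $\dot w=v$, $w(0)=w^0$) and $\dot x(t)=f(x(t),w(t),t)$, $x(0)=x^0$, on all of $[0,T]$, and put $$G(v)=\int_0^T\Bigl[\frac{mc}{2}|v(t)|^2+c\,\ell(w(t),x(t),t)\Bigr]\phi(t)\,dt\in[0,\infty].$$ Suppose that $v$, with trajectory $(x,w)$, is a minimizer of $G$ among all admissible controls, with $G(v)<\infty$. Let $$H(\xi,u,p,q,t)=-\frac{1}{\phi(t)}\frac{|q|^2}{2mc}+c\,\ell(u,\xi,t)\,\phi(t)+p\cdot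 f(\xi,u,t).$$ Then there exist costates $p_x:[0,T]\to\mathbb R^n$ and $p_w:[0,T]\to\mathbb R^N$ such that, for every $t\in[0,T]$ (with one-sided derivatives at the endpoints), Hamilton's equations $\dot x=H_p$, $\dot w=H_q$, $\dot p_x=-H_\xi$, $\dot p_w=-H_u$ hold along $(x(t),w(t),p_x(t),p_w(t),t)$; explicitly, $$\begin{cases} \dot x(t)=f(x(t),w(t),t),\\ \dot w(t)=-p_w(t)/(mc\,\phi(t)),\\ \dot p_x(t)=-f_\xi(x(t),w(t),t)^{\top}p_x(t)-c\,\ell_\xi(w(t),x(t),t)\,\phi(t),\\ \dot p_w(t)=-f_u(x(t),w(t),t)^{\top}p_x(t)-c\,\ell_u(w(t),x(t),t)\,\phi(t), \end{cases}$$ where $\ell_\xi,\ell_u$ are gradients and $f_\xi,f_u$ Jacobian matrices, together with $x(0)=x^0$, $w(0)=w^0$ and $p_x(T)=p_w(T)=0$. -/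

import Mathlib

open Set MeasureTheory
open scoped ContDiff

noncomputable section

/-- `g (a, b, t)` is continuous on `A × B × [0,T]`, differentiable in `(a, b)` for every
`t ∈ [0,T]`, and its derivative in `(a, b)` is continuous on `A × B × [0,T]`. -/
structure IsC1InState {A B F : Type*}
    [NormedAddCommGroup A] [NormedSpace ℝ A] [NormedAddCommGroup B] [NormedSpace ℝ B]
    [NormedAddCommGroup F] [NormedSpace ℝ F]
    (T : ℝ) (g : A → B → ℝ → F) : Prop where
  continuousOn : ContinuousOn (fun z : (A × B) × ℝ => g z.1.1 z.1.2 z.2) (univ ×ˢ Icc 0 T)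
  differentiable : ∀ t ∈ Icc 0 T, Differentiable ℝ (fun y : A × B => g y.1 y.2 t)
  continuousOn_fderiv : ContinuousOn
    (fun z : (A × B) × ℝ => fderiv ℝ (fun y : A × B => g y.1 y.2 z.2) z.1) (univ ×ˢ Icc 0 T)

/-- The curves `x`, `w` solve `ẋ = f(x, w, t)`, `ẇ = v` on `[0,T]` with `x(0) = x₀`,
`w(0) = w₀`. The control `v` is measurable and integrable, and `w` is the absolutely continuous
solution of `ẇ = v`. -/
structure IsAdmissible {n N : ℕ} (T : ℝ)
    (f : EuclideanSpace ℝ (Fin n) → EuclideanSpace ℝ (Fin N) → ℝ → EuclideanSpace ℝ (Fin n))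
    (x₀ : EuclideanSpace ℝ (Fin n)) (w₀ : EuclideanSpace ℝ (Fin N))
    (v : ℝ → EuclideanSpace ℝ (Fin N))
    (x : ℝ → EuclideanSpace ℝ (Fin n)) (w : ℝ → EuclideanSpace ℝ (Fin N)) : Prop where
  integrableOn : IntegrableOn v (Icc 0 T)
  weight_eq : ∀ t ∈ Icc 0 T, w t = w₀ + ∫ s in (0 : ℝ)..t, v s
  state_init : x 0 = x₀
  state_deriv : ∀ t ∈ Icc 0 T, HasDerivWithinAt x (f (x t) (w t) t) (Icc 0 T) t

/-- The functional `G`, with values in `[0,∞]`; its integrand is nonnegative when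
`m`, `c`, `ℓ`, `φ` are, and `G` is infinite when the integrand is not integrable. -/
def costG {n N : ℕ} (T m c : ℝ) (φ : ℝ → ℝ)
    (ℓ : EuclideanSpace ℝ (Fin N) → EuclideanSpace ℝ (Fin n) → ℝ → ℝ)
    (v : ℝ → EuclideanSpace ℝ (Fin N))
    (x : ℝ → EuclideanSpace ℝ (Fin n)) (w : ℝ → EuclideanSpace ℝ (Fin N)) : ENNReal :=
  ∫⁻ t in Icc 0 T, ENNReal.ofReal ((m * c / 2 * ‖v t‖ ^ 2 + c * ℓ (w t) (x t) t) * φ t)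

/-- The control `v`, with its trajectory `(x, w)`, attains the finite minimum of `G` among all
admissible controls. -/
structure IsMinimizer {n N : ℕ} (T m c : ℝ) (φ : ℝ → ℝ)
    (f : EuclideanSpace ℝ (Fin n) → EuclideanSpace ℝ (Fin N) → ℝ → EuclideanSpace ℝ (Fin n))
    (ℓ : EuclideanSpace ℝ (Fin N) → EuclideanSpace ℝ (Fin n) → ℝ → ℝ)
    (x₀ : EuclideanSpace ℝ (Fin n)) (w₀ : EuclideanSpace ℝ (Fin N))
    (v : ℝ → EuclideanSpace ℝ (Fin N))
    (x : ℝ → EuclideanSpace ℝ (Fin n)) (w : ℝ → EuclideanSpace ℝ (Fin N)) : Prop where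
  admissible : IsAdmissible T f x₀ w₀ v x w
  cost_ne_top : costG T m c φ ℓ v x w ≠ ⊤
  cost_le : ∀ v' x' w', IsAdmissible T f x₀ w₀ v' x' w' →
    costG T m c φ ℓ v x w ≤ costG T m c φ ℓ v' x' w'

/-- The Hamiltonian
`H(ξ, u, p, q, t) = -(1 / φ(t)) |q|² / (2mc) + c ℓ(u, ξ, t) φ(t) + p · f(ξ, u, t)`. -/
def hamiltonian {n N : ℕ} (m c : ℝ) (φ : ℝ → ℝ)
    (f : EuclideanSpace ℝ (Fin n) → EuclideanSpace ℝ (Fin N) → ℝ → EuclideanSpace ℝ (Fin n))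
    (ℓ : EuclideanSpace ℝ (Fin N) → EuclideanSpace ℝ (Fin n) → ℝ → ℝ)
    (ξ : EuclideanSpace ℝ (Fin n)) (u : EuclideanSpace ℝ (Fin N))
    (p : EuclideanSpace ℝ (Fin n)) (q : EuclideanSpace ℝ (Fin N)) (t : ℝ) : ℝ :=
  -(1 / φ t) * (‖q‖ ^ 2 / (2 * m * c)) + c * ℓ u ξ t * φ t + inner ℝ p (f ξ u t)

/-- The canonical equations `ẋ = H_p`, `ẇ = H_q`, `ṗ_x = -H_ξ`, `ṗ_w = -H_u` on `[0,T]`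
(one-sided derivatives at the endpoints). -/
structure SolvesCanonicalEquations {n N : ℕ} (T : ℝ)
    (H : EuclideanSpace ℝ (Fin n) → EuclideanSpace ℝ (Fin N) →
      EuclideanSpace ℝ (Fin n) → EuclideanSpace ℝ (Fin N) → ℝ → ℝ)
    (x : ℝ → EuclideanSpace ℝ (Fin n)) (w : ℝ → EuclideanSpace ℝ (Fin N))
    (px : ℝ → EuclideanSpace ℝ (Fin n)) (pw : ℝ → EuclideanSpace ℝ (Fin N)) : Prop where
  state : ∀ t ∈ Icc 0 T, HasDerivWithinAt x
    (gradient (fun p => H (x t) (w t) p (pw t) t) (px t)) (Icc 0 T) t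
  weight : ∀ t ∈ Icc 0 T, HasDerivWithinAt w
    (gradient (fun q => H (x t) (w t) (px t) q t) (pw t)) (Icc 0 T) t
  state_costate : ∀ t ∈ Icc 0 T, HasDerivWithinAt px
    (-gradient (fun ξ => H ξ (w t) (px t) (pw t) t) (x t)) (Icc 0 T) t
  weight_costate : ∀ t ∈ Icc 0 T, HasDerivWithinAt pw
    (-gradient (fun u => H (x t) u (px t) (pw t) t) (w t)) (Icc 0 T) t

end

/-! Along the optimal trajectory, `px` is defined by the linear adjoint equation with `px T = 0`.
Put `a = f_uᵀ px + c φ ℓ_u` and `pw t = ∫ a` over `[t, T]`. The costate equations then hold by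
construction, and only `v = -pw / (m c φ)` needs minimality.

If the weight curve moves by `k`, the state moves by some `e` of size at most a constant times `sup
‖k‖`. Because `⟪px, e⟫` vanishes at both ends, the adjoint equation eliminates `e`: the running cost
changes by at most `∫ ⟪a, k⟫ + o(sup ‖k‖)` (`exists_variation_cost_le`). For `k` the primitive of a
control variation, integration by parts (`intervalIntegral_inner_primitive`) turns `a` into `pw`.

Hence `h = m c φ v + pw` is the `L²` gradient of `G`. Finite cost puts `v`, and so `h`, in `L²`. The
control `v - ε h` is therefore a legitimate competitor, and comparing costs as `ε → 0` forces `∫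
‖h‖² ≤ 0` (`IsMinimizer.ae_stationary`). So `v` agrees a.e. with a continuous function, and `w` is
differentiable at every time. -/

/-! ### Differential equations solvable on the whole interval -/

/-- The radial retraction of a normed space onto the closed ball of radius `R`. -/
noncomputable def radialRetraction {E : Type*} [NormedAddCommGroup E] [NormedSpace ℝ E]
    (R : ℝ) (x : E) : E := (R / max R ‖x‖) • x

section RadialRetraction

variable {E : Type*} [NormedAddCommGroup E] [NormedSpace ℝ E] {R : ℝ}

lemma norm_radialRetraction_le (hR : 0 < R) (x : E) : ‖radialRetraction R x‖ ≤ R := by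
  have h : 0 < max R ‖x‖ := lt_max_of_lt_left hR
  rw [radialRetraction, norm_smul, Real.norm_of_nonneg (by positivity), div_mul_eq_mul_div,
    div_le_iff₀ h]
  exact mul_le_mul_of_nonneg_left (le_max_right _ _) hR.le

lemma norm_radialRetraction_le_norm (hR : 0 < R) (x : E) : ‖radialRetraction R x‖ ≤ ‖x‖ := by
  have h : 0 < max R ‖x‖ := lt_max_of_lt_left hR
  rw [radialRetraction, norm_smul, Real.norm_of_nonneg (by positivity)]
  exact mul_le_of_le_one_left (norm_nonneg _) ((div_le_one h).2 (le_max_left _ _))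

lemma radialRetraction_of_norm_le (hR : 0 < R) {x : E} (hx : ‖x‖ ≤ R) :
    radialRetraction R x = x := by
  rw [radialRetraction, max_eq_left hx, div_self hR.ne', one_smul]

/-- Moving the point with the scaling factor fixed costs at most `‖x - y‖`, and changing the factor
costs at most `‖x - y‖` again; no inner product is needed. -/
lemma lipschitzWith_radialRetraction (hR : 0 < R) :
    LipschitzWith 2 (radialRetraction R : E → E) := by
  refine LipschitzWith.of_dist_le_mul fun x y => ?_
  have hx : 0 < max R ‖x‖ := lt_max_of_lt_left hR
  have hy : 0 < max R ‖y‖ := lt_max_of_lt_left hR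
  rw [dist_eq_norm, dist_eq_norm]
  have key : radialRetraction R x - radialRetraction R y
      = (R / max R ‖x‖) • (x - y) + (R / max R ‖x‖ - R / max R ‖y‖) • y := by
    simp only [radialRetraction, smul_sub, sub_smul]; abel
  have h1 : ‖(R / max R ‖x‖) • (x - y)‖ ≤ ‖x - y‖ := by
    rw [norm_smul, Real.norm_of_nonneg (by positivity)]
    exact mul_le_of_le_one_left (norm_nonneg _) ((div_le_one hx).2 (le_max_left _ _))
  have h2 : ‖(R / max R ‖x‖ - R / max R ‖y‖) • y‖ ≤ ‖x - y‖ := by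
    have e : R / max R ‖x‖ - R / max R ‖y‖
        = (R / max R ‖x‖) * ((max R ‖y‖ - max R ‖x‖) / max R ‖y‖) := by
      field_simp
    have hm : |max R ‖y‖ - max R ‖x‖| ≤ ‖x - y‖ := by
      refine (abs_max_sub_max_le_max _ _ _ _).trans ?_
      rw [sub_self, abs_zero, max_eq_right (abs_nonneg _), norm_sub_rev]
      exact abs_norm_sub_norm_le _ _
    rw [e, norm_smul, norm_mul, Real.norm_of_nonneg (by positivity : 0 ≤ R / max R ‖x‖), norm_div,
      Real.norm_eq_abs, Real.norm_of_nonneg hy.le, mul_assoc]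
    refine (mul_le_of_le_one_left (by positivity)
      ((div_le_one hx).2 (le_max_left _ _))).trans ?_
    rw [div_mul_eq_mul_div, div_le_iff₀ hy]
    exact mul_le_mul hm (le_max_right _ _) (norm_nonneg _) (norm_nonneg _)
  rw [key]
  refine (norm_add_le _ _).trans ?_
  simp only [NNReal.coe_ofNat]
  linarith

end RadialRetraction

/-- A vector field on `[0,T]` which is Lipschitz and of linear growth on a ball so large that
Grönwall's inequality keeps solutions inside has a solution on all of `[0,T]` starting at `0`. -/
theorem exists_solution_of_lipschitzOn_closedBall {E : Type*} [NormedAddCommGroup E]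
    [NormedSpace ℝ E] [CompleteSpace E] {T K R δ : ℝ} (hT : 0 < T) (hK : 0 < K) (hR : 0 < R)
    (hδ : 0 ≤ δ) (hδR : δ * Real.exp (K * T) ≤ R) (g : ℝ → E → E)
    (hlip : ∀ t ∈ Icc 0 T, ∀ x y, ‖x‖ ≤ R → ‖y‖ ≤ R → ‖g t x - g t y‖ ≤ K * ‖x - y‖)
    (hcont : ∀ x, ‖x‖ ≤ R → ContinuousOn (fun t => g t x) (Icc 0 T))
    (hgrowth : ∀ t ∈ Icc 0 T, ∀ x, ‖x‖ ≤ R → ‖g t x‖ ≤ K * (‖x‖ + δ)) :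
    ∃ e : ℝ → E, e 0 = 0 ∧ ∀ t ∈ Icc 0 T, ‖e t‖ ≤ δ * Real.exp (K * T) ∧
      HasDerivWithinAt e (g t (e t)) (Icc 0 T) t := by
  -- Composed with the retraction, the field is globally Lipschitz and bounded by `K * (R + δ)`. A
  -- ball of radius speed times `T` then lets Picard–Lindelöf reach `T` in one step.
  have hPL : IsPicardLindelof (fun t x => g t (radialRetraction R x))
      (⟨0, left_mem_Icc.2 hT.le⟩ : Icc (0 : ℝ) T) (0 : E) (K * (R + δ) * T).toNNReal 0
      (K * (R + δ)).toNNReal (K.toNNReal * 2) := by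
    refine ⟨fun t ht => ?_, fun x _ => ?_, fun t ht x _ => ?_, ?_⟩
    · have h1 : LipschitzOnWith K.toNNReal (g t) {x | ‖x‖ ≤ R} := by
        refine LipschitzOnWith.of_dist_le_mul fun x hx y hy => ?_
        rw [dist_eq_norm, dist_eq_norm, Real.coe_toNNReal _ hK.le]
        exact hlip t ht x y hx hy
      exact h1.comp (lipschitzWith_radialRetraction hR).lipschitzOnWith
        fun x _ => norm_radialRetraction_le hR x
    · exact hcont _ (norm_radialRetraction_le hR x)
    · rw [Real.coe_toNNReal _ (by positivity)]
      refine (hgrowth t ht _ (norm_radialRetraction_le hR x)).trans ?_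
      gcongr
      exact norm_radialRetraction_le hR x
    · simp only [sub_zero, sub_self, NNReal.coe_zero]
      rw [Real.coe_toNNReal _ (by positivity), Real.coe_toNNReal _ (by positivity),
        max_eq_left hT.le]
  obtain ⟨e, he0, he⟩ := hPL.exists_eq_forall_mem_Icc_hasDerivWithinAt₀
  -- Grönwall from the value zero gives `δ * (exp (K * t) - 1)`. Thus `e` stays where the retraction
  -- is the identity and solves the original equation.
  have hbound : ∀ t ∈ Icc 0 T, ‖e t‖ ≤ δ * Real.exp (K * T) := by
    intro t ht
    have := norm_le_gronwallBound_of_norm_deriv_right_le (f := e) (δ := 0) (K := K) (ε := K * δ)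
      (a := 0) (b := T) (fun t ht => (he t ht).continuousWithinAt)
      (fun t ht => (he t (Ico_subset_Icc_self ht)).mono_of_mem_nhdsWithin
        (Icc_mem_nhdsGE_of_mem ht)) (by simpa using he0)
      (fun t ht => by
        refine (hgrowth t (Ico_subset_Icc_self ht) _ (norm_radialRetraction_le hR _)).trans ?_
        rw [mul_add]
        gcongr
        exact norm_radialRetraction_le_norm hR _) t ht
    refine this.trans ?_
    simp only [gronwallBound_of_K_ne_0 hK.ne', zero_mul, zero_add,
      mul_div_cancel_left₀ _ hK.ne', sub_zero]
    have : Real.exp (K * t) ≤ Real.exp (K * T) := by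
      gcongr; exact ht.2
    exact mul_le_mul_of_nonneg_left (by linarith) hδ
  refine ⟨e, he0, fun t ht => ⟨hbound t ht, ?_⟩⟩
  have := he t ht
  rwa [radialRetraction_of_norm_le hR ((hbound t ht).trans hδR)] at this

/-! ### Estimates uniform in time around a curve -/

section UniformExpansion

variable {C F : Type*} [NormedAddCommGroup C] [NormedSpace ℝ C]
  [NormedAddCommGroup F] [NormedSpace ℝ F] {T : ℝ} {g : C → ℝ → F} {z : ℝ → C}

/-- Recentring at `z t` turns a moving tube into a fixed product; for `S` a closed ball this is
compact, which yields bounds independent of `t`. -/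
lemma continuousOn_fderiv_tube
    (hg' : ContinuousOn (fun p : C × ℝ => fderiv ℝ (fun y => g y p.2) p.1) (univ ×ˢ Icc 0 T))
    (hz : ContinuousOn z (Icc 0 T)) (S : Set C) :
    ContinuousOn (fun p : C × ℝ => fderiv ℝ (fun y => g y p.2) (z p.2 + p.1)) (S ×ˢ Icc 0 T) := by
  refine hg'.comp (f := fun p : C × ℝ => (z p.2 + p.1, p.2)) (ContinuousOn.prodMk
    ((hz.comp continuousOn_snd fun p hp => hp.2).add continuousOn_fst) continuousOn_snd) ?_
  exact fun p hp => ⟨mem_univ _, hp.2⟩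

/-- A map with continuous derivative is Lipschitz in a tube around a curve, uniformly in time. -/
lemma exists_lipschitz_tube [ProperSpace C] (hg : ∀ t ∈ Icc 0 T, Differentiable ℝ (fun y => g y t))
    (hg' : ContinuousOn (fun p : C × ℝ => fderiv ℝ (fun y => g y p.2) p.1) (univ ×ˢ Icc 0 T))
    (hz : ContinuousOn z (Icc 0 T)) :
    ∃ L > 0, ∀ t ∈ Icc 0 T, ∀ a b : C, ‖a‖ ≤ 1 → ‖b‖ ≤ 1 →
      ‖g (z t + a) t - g (z t + b) t‖ ≤ L * ‖a - b‖ := by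
  obtain ⟨L, hL⟩ := ((isCompact_closedBall (0 : C) 1).prod isCompact_Icc).exists_bound_of_continuousOn
    (continuousOn_fderiv_tube hg' hz (Metric.closedBall 0 1))
  refine ⟨max L 1, by positivity, fun t ht a b ha hb => ?_⟩
  have hbound : ∀ y ∈ Metric.closedBall (z t) 1, ‖fderiv ℝ (fun y => g y t) y‖ ≤ max L 1 := by
    intro y hy
    have := hL (y - z t, t) ⟨by simpa [dist_eq_norm] using hy, ht⟩
    simp only [add_sub_cancel] at this
    exact this.trans (le_max_left _ _)
  have := (convex_closedBall (z t) 1).norm_image_sub_le_of_norm_fderiv_le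
    (f := fun y => g y t) (fun y _ => hg t ht y) hbound (x := z t + b) (y := z t + a)
    (by simpa using hb) (by simpa using ha)
  simpa using this

/-- First-order expansion along a curve, uniform in time. -/
lemma exists_uniform_expansion [ProperSpace C]
    (hg : ∀ t ∈ Icc 0 T, Differentiable ℝ (fun y => g y t))
    (hg' : ContinuousOn (fun p : C × ℝ => fderiv ℝ (fun y => g y p.2) p.1) (univ ×ˢ Icc 0 T))
    (hz : ContinuousOn z (Icc 0 T)) {η : ℝ} (hη : 0 < η) :
    ∃ δ > 0, ∀ t ∈ Icc 0 T, ∀ a : C, ‖a‖ ≤ δ →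
      ‖g (z t + a) t - g (z t) t - fderiv ℝ (fun y => g y t) (z t) a‖ ≤ η * ‖a‖ := by
  have huc := ((isCompact_closedBall (0 : C) 1).prod
    (isCompact_Icc (a := 0) (b := T))).uniformContinuousOn_of_continuous
    (continuousOn_fderiv_tube hg' hz (Metric.closedBall 0 1))
  obtain ⟨δ, hδ, h⟩ := Metric.uniformContinuousOn_iff.1 huc η hη
  -- Half of `δ` gives the strict inequality on a closed ball; the cap `1` stays in the compact set.
  refine ⟨min (δ / 2) 1, by positivity, fun t ht a ha => ?_⟩
  have hbound : ∀ y ∈ Metric.closedBall (z t) (min (δ / 2) 1),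
      ‖fderiv ℝ (fun y => g y t) y - fderiv ℝ (fun y => g y t) (z t)‖ ≤ η := by
    intro y hy
    rw [mem_closedBall_iff_norm] at hy
    have hy1 := hy.trans (min_le_right _ _)
    have hyδ : ‖y - z t‖ < δ := by have := hy.trans (min_le_left _ _); linarith
    have := h (y - z t, t) ⟨by simpa using hy1, ht⟩ (0, t) ⟨by simp, ht⟩
      (by simpa [Prod.dist_eq, dist_eq_norm] using hyδ)
    simpa [dist_eq_norm] using this.le
  have := (convex_closedBall (z t) (min (δ / 2) 1)).norm_image_sub_le_of_norm_fderiv_le'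
    (f := fun y => g y t) (fun y _ => hg t ht y) hbound (x := z t) (y := z t + a)
    (Metric.mem_closedBall_self (by positivity)) (by simpa using ha)
  simpa using this

end UniformExpansion

/-! ### Integration by parts for integrable functions -/

section IntegrationByParts

/-- Primitives of integrable functions are absolutely continuous, so the product rule integrates
although the derivatives exist only a.e. -/
lemma intervalIntegral_mul_primitive_add_primitive_mul {a h : ℝ → ℝ} {T : ℝ}
    (ha : IntervalIntegrable a volume 0 T) (hh : IntervalIntegrable h volume 0 T) :
    ∫ t in (0 : ℝ)..T, (a t * (∫ s in (0 : ℝ)..t, h s) + (∫ s in (0 : ℝ)..t, a s) * h t)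
      = (∫ t in (0 : ℝ)..T, a t) * ∫ t in (0 : ℝ)..T, h t := by
  have := (ha.absolutelyContinuousOnInterval_intervalIntegral
    (c := 0) left_mem_uIcc).integral_deriv_mul_eq_sub
    (hh.absolutelyContinuousOnInterval_intervalIntegral (c := 0) left_mem_uIcc)
  simp only [intervalIntegral.integral_same, mul_zero, sub_zero] at this
  rw [← this]
  refine intervalIntegral.integral_congr_ae ?_
  filter_upwards [ha.ae_hasDerivAt_integral, hh.ae_hasDerivAt_integral] with t h1 h2 ht
  have ht' := uIoc_subset_uIcc ht
  rw [(h1 ht' 0 left_mem_uIcc).deriv, (h2 ht' 0 left_mem_uIcc).deriv]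

variable {N : ℕ} {a h : ℝ → EuclideanSpace ℝ (Fin N)} {T : ℝ}

lemma intervalIntegral_euclidean_apply {u v : ℝ} (ha : IntervalIntegrable a volume u v)
    (i : Fin N) : (∫ t in u..v, a t) i = ∫ t in u..v, a t i :=
  ((EuclideanSpace.proj (𝕜 := ℝ) i).intervalIntegral_comp_comm ha).symm

lemma IntervalIntegrable.euclidean_apply {u v : ℝ} (ha : IntervalIntegrable a volume u v)
    (i : Fin N) : IntervalIntegrable (fun t => a t i) volume u v :=
  ⟨(EuclideanSpace.proj (𝕜 := ℝ) i).integrable_comp ha.1,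
    (EuclideanSpace.proj (𝕜 := ℝ) i).integrable_comp ha.2⟩

/-- Integration by parts for primitives of integrable functions. -/
theorem intervalIntegral_inner_primitive (ha : IntervalIntegrable a volume 0 T)
    (hh : IntervalIntegrable h volume 0 T) :
    ∫ t in (0 : ℝ)..T, inner ℝ (a t) (∫ s in (0 : ℝ)..t, h s)
      = ∫ t in (0 : ℝ)..T, inner ℝ ((∫ s in (0 : ℝ)..T, a s) - ∫ s in (0 : ℝ)..t, a s) (h t) := by
  have hsub : ∀ {b : ℝ → EuclideanSpace ℝ (Fin N)}, IntervalIntegrable b volume 0 T →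
      ∀ t ∈ uIcc 0 T, IntervalIntegrable b volume 0 t := fun hb t ht =>
    hb.mono_set (uIcc_subset_uIcc left_mem_uIcc ht)
  have prim : ∀ {b : ℝ → ℝ}, IntervalIntegrable b volume 0 T →
      ContinuousOn (fun t => ∫ s in (0 : ℝ)..t, b s) (uIcc 0 T) := fun hb =>
    intervalIntegral.continuousOn_primitive_interval' hb left_mem_uIcc
  have e1 : ∫ t in (0 : ℝ)..T, inner ℝ (a t) (∫ s in (0 : ℝ)..t, h s)
      = ∫ t in (0 : ℝ)..T, ∑ i, a t i * ∫ s in (0 : ℝ)..t, h s i := by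
    refine intervalIntegral.integral_congr fun t ht => ?_
    simp only [PiLp.inner_apply, RCLike.inner_apply, conj_trivial,
      intervalIntegral_euclidean_apply (hsub hh t ht)]
    exact Finset.sum_congr rfl fun i _ => mul_comm _ _
  have e2 : ∫ t in (0 : ℝ)..T, inner ℝ ((∫ s in (0 : ℝ)..T, a s) - ∫ s in (0 : ℝ)..t, a s) (h t)
      = ∫ t in (0 : ℝ)..T, ∑ i, ((∫ s in (0 : ℝ)..T, a s i) * h t i
        - (∫ s in (0 : ℝ)..t, a s i) * h t i) := by
    refine intervalIntegral.integral_congr fun t ht => ?_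
    simp only [PiLp.inner_apply, RCLike.inner_apply, conj_trivial, PiLp.sub_apply,
      intervalIntegral_euclidean_apply (hsub ha t ht), intervalIntegral_euclidean_apply ha]
    exact Finset.sum_congr rfl fun i _ => by ring
  have i1 : ∀ i, IntervalIntegrable (fun t => a t i * ∫ s in (0 : ℝ)..t, h s i) volume 0 T :=
    fun i => (ha.euclidean_apply i).mul_continuousOn (prim (hh.euclidean_apply i))
  have i2 : ∀ i, IntervalIntegrable (fun t => (∫ s in (0 : ℝ)..t, a s i) * h t i) volume 0 T :=
    fun i => (hh.euclidean_apply i).continuousOn_mul (prim (ha.euclidean_apply i))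
  have i3 : ∀ i, IntervalIntegrable (fun t => (∫ s in (0 : ℝ)..T, a s i) * h t i) volume 0 T :=
    fun i => (hh.euclidean_apply i).const_mul _
  rw [e1, e2, intervalIntegral.integral_finsetSum fun i _ => i1 i,
    intervalIntegral.integral_finsetSum fun i _ => (i3 i).sub (i2 i)]
  refine Finset.sum_congr rfl fun i _ => ?_
  rw [intervalIntegral.integral_sub (i3 i) (i2 i), intervalIntegral.integral_const_mul,
    ← intervalIntegral_mul_primitive_add_primitive_mul (ha.euclidean_apply i)
      (hh.euclidean_apply i), intervalIntegral.integral_add (i1 i) (i2 i), add_sub_cancel_right]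

end IntegrationByParts

/-! ### The adjoint equation and the perturbed state equation -/

/-- Terminal value problem for a linear equation. -/
theorem exists_solution_linear_terminal {E : Type*} [NormedAddCommGroup E] [NormedSpace ℝ E]
    [CompleteSpace E] {T : ℝ} (hT : 0 < T) {A : ℝ → E →L[ℝ] E} {b : ℝ → E}
    (hA : ContinuousOn A (Icc 0 T)) (hb : ContinuousOn b (Icc 0 T)) :
    ∃ p : ℝ → E, p T = 0 ∧
      ∀ t ∈ Icc 0 T, HasDerivWithinAt p (-(A t (p t)) - b t) (Icc 0 T) t := by
  obtain ⟨K, hK⟩ := isCompact_Icc.exists_bound_of_continuousOn hA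
  obtain ⟨B, hB⟩ := isCompact_Icc.exists_bound_of_continuousOn hb
  have hrev : MapsTo (fun t => T - t) (Icc 0 T) (Icc 0 T) := fun t ht =>
    ⟨by linarith [ht.2], by linarith [ht.1]⟩
  have hrevc : ContinuousOn (fun t => T - t) (Icc 0 T) := by fun_prop
  have hK1 : 0 < max K 1 := by positivity
  have hB1 : 0 < max B 1 := by positivity
  have hδ : 0 < max B 1 / max K 1 := by positivity
  -- Time is reversed. The field is affine, hence globally Lipschitz, so the radius may be the
  -- Grönwall bound itself; `δ = B / K` (both raised to at least `1`) makes `K * δ` the bound on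
  -- `b`.
  obtain ⟨q, hq0, hq⟩ := exists_solution_of_lipschitzOn_closedBall (E := E) hT hK1
    (R := max B 1 / max K 1 * Real.exp (max K 1 * T)) (by positivity) hδ.le le_rfl
    (fun t y => A (T - t) y + b (T - t))
    (fun t ht y y' _ _ => by
      rw [add_sub_add_right_eq_sub, ← map_sub]
      exact (A (T - t)).le_of_opNorm_le ((hK _ (hrev ht)).trans (le_max_left _ _)) _)
    (fun y _ => ((hA.comp hrevc hrev).clm_apply continuousOn_const).add (hb.comp hrevc hrev))
    (fun t ht y _ => by
      refine (norm_add_le _ _).trans ?_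
      rw [mul_add, mul_div_cancel₀ _ hK1.ne']
      exact add_le_add ((A (T - t)).le_of_opNorm_le ((hK _ (hrev ht)).trans (le_max_left _ _)) _)
        ((hB _ (hrev ht)).trans (le_max_left _ _)))
  refine ⟨fun t => q (T - t), by simpa using hq0, fun t ht => ?_⟩
  have h1 := (hq _ (hrev ht)).2
  have h2 : HasDerivWithinAt (fun t => T - t) (-1) (Icc 0 T) t := by
    simpa using (hasDerivWithinAt_id t (Icc 0 T)).const_sub T
  refine HasDerivWithinAt.congr_deriv (h1.scomp t h2 hrev) ?_
  rw [neg_one_smul, sub_sub_cancel, neg_add, ← sub_eq_add_neg]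

section StateEquation

variable {E W F : Type*} [NormedAddCommGroup E] [NormedSpace ℝ E]
  [NormedAddCommGroup W] [NormedSpace ℝ W] [NormedAddCommGroup F] [NormedSpace ℝ F]
  {T : ℝ} {x : ℝ → E} {w : ℝ → W}

lemma IsC1InState.comp_continuousOn {g : E → W → ℝ → F} (hg : IsC1InState T g)
    (hx : ContinuousOn x (Icc 0 T)) (hw : ContinuousOn w (Icc 0 T)) :
    ContinuousOn (fun t => g (x t) (w t) t) (Icc 0 T) :=
  hg.continuousOn.comp (f := fun t => ((x t, w t), t)) ((hx.prodMk hw).prodMk continuousOn_id)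
    fun _ ht => ⟨mem_univ _, ht⟩

lemma IsC1InState.fderiv_comp_continuousOn {g : E → W → ℝ → F} (hg : IsC1InState T g)
    (hx : ContinuousOn x (Icc 0 T)) (hw : ContinuousOn w (Icc 0 T)) :
    ContinuousOn (fun t => fderiv ℝ (fun y : E × W => g y.1 y.2 t) (x t, w t)) (Icc 0 T) :=
  hg.continuousOn_fderiv.comp (f := fun t => ((x t, w t), t))
    ((hx.prodMk hw).prodMk continuousOn_id) fun _ ht => ⟨mem_univ _, ht⟩

/-- Small perturbations of the parameter curve `w` perturb the trajectory `x` by a comparable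
amount, and the perturbed trajectory still exists on all of `[0,T]`. -/
theorem exists_perturbed_trajectory [ProperSpace E] [ProperSpace W] (hT : 0 < T)
    {f : E → W → ℝ → E} (hf : IsC1InState T f)
    (hx : ContinuousOn x (Icc 0 T)) (hw : ContinuousOn w (Icc 0 T)) :
    ∃ C ≥ 1, ∀ (κ : ℝ) (k : ℝ → W), 0 ≤ κ → C * κ ≤ 1 → ContinuousOn k (Icc 0 T) →
      (∀ t ∈ Icc 0 T, ‖k t‖ ≤ κ) → ∃ e : ℝ → E, e 0 = 0 ∧ ∀ t ∈ Icc 0 T, ‖e t‖ ≤ C * κ ∧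
        HasDerivWithinAt e (f (x t + e t) (w t + k t) t - f (x t) (w t) t) (Icc 0 T) t := by
  obtain ⟨L, hL, hlip⟩ := exists_lipschitz_tube (g := fun (y : E × W) t => f y.1 y.2 t)
    hf.differentiable hf.continuousOn_fderiv (hx.prodMk hw)
  have hC : 1 ≤ Real.exp (L * T) := Real.one_le_exp (by positivity)
  refine ⟨Real.exp (L * T), hC, fun κ k hκ hκ1 hk hkκ => ?_⟩
  have hk1 : ∀ t ∈ Icc 0 T, ‖k t‖ ≤ 1 := fun t ht => (hkκ t ht).trans
    ((le_mul_of_one_le_left hκ hC).trans hκ1)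
  have hxe : ∀ y : E, ContinuousOn (fun t => x t + y) (Icc 0 T) := fun y =>
    hx.add continuousOn_const
  -- The field for `e` vanishes when `e` and `k` do, so its growth is `L * (‖e‖ + κ)`. The radius
  -- `1` is that of the Lipschitz tube.
  obtain ⟨e, he0, he⟩ := exists_solution_of_lipschitzOn_closedBall (E := E) hT hL
    one_pos hκ (by rwa [mul_comm])
    (fun t y => f (x t + y) (w t + k t) t - f (x t) (w t) t)
    (fun t ht y y' hy hy' => by
      have := hlip t ht (y, k t) (y', k t) (by simp [Prod.norm_def, hy, hk1 t ht])
        (by simp [Prod.norm_def, hy', hk1 t ht])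
      simpa [Prod.norm_def] using this)
    (fun y _ => (hf.comp_continuousOn (hxe y) (hw.add hk)).sub (hf.comp_continuousOn hx hw))
    (fun t ht y hy => by
      have := hlip t ht (y, k t) (0, 0) (by simp [Prod.norm_def, hy, hk1 t ht])
        (by simp [Prod.norm_def])
      simp only [Prod.fst_add, Prod.snd_add, add_zero, Prod.mk_sub_mk, sub_zero] at this
      refine this.trans (mul_le_mul_of_nonneg_left ?_ hL.le)
      rw [Prod.norm_def]
      exact max_le (le_add_of_nonneg_right hκ) ((hkκ t ht).trans
        (le_add_of_nonneg_left (norm_nonneg _))))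
  exact ⟨e, he0, fun t ht => ⟨by rw [mul_comm]; exact (he t ht).1, (he t ht).2⟩⟩

end StateEquation

/-! ### First variation of the running cost -/

lemma ContinuousLinearMap.apply_eq_comp_inl_add_comp_inr {E W F : Type*}
    [NormedAddCommGroup E] [NormedSpace ℝ E] [NormedAddCommGroup W] [NormedSpace ℝ W]
    [NormedAddCommGroup F] [NormedSpace ℝ F]
    (D : E × W →L[ℝ] F) (a : E) (b : W) :
    D (a, b) = D.comp (.inl ℝ E W) a + D.comp (.inr ℝ E W) b := by
  simp [← map_add]

section FirstVariation

variable {E W : Type*} [NormedAddCommGroup E] [InnerProductSpace ℝ E] [CompleteSpace E]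
  [ProperSpace E] [NormedAddCommGroup W] [InnerProductSpace ℝ W] [CompleteSpace W] [ProperSpace W]
  {T : ℝ}

/-- First variation of a running cost `∫ ψ ℓ` under the state equation: with the costate `p`
solving the adjoint equation, it is represented by
`ψ ℓ_u + f_uᵀ p`. -/
theorem exists_variation_cost_le (hT : 0 < T) {f : E → W → ℝ → E} (hf : IsC1InState T f)
    {ℓ : W → E → ℝ → ℝ} (hℓ : IsC1InState T ℓ) {ψ : ℝ → ℝ} (hψ : ContinuousOn ψ (Icc 0 T))
    {x : ℝ → E} {w : ℝ → W} (hw : ContinuousOn w (Icc 0 T))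
    (hx : ∀ t ∈ Icc 0 T, HasDerivWithinAt x (f (x t) (w t) t) (Icc 0 T) t)
    {Df : ℝ → E × W →L[ℝ] E} {Dℓ : ℝ → W × E →L[ℝ] ℝ}
    (hDf : Df = fun t => fderiv ℝ (fun y : E × W => f y.1 y.2 t) (x t, w t))
    (hDℓ : Dℓ = fun t => fderiv ℝ (fun y : W × E => ℓ y.1 y.2 t) (w t, x t))
    {p : ℝ → E} (hpT : p T = 0)
    (hp : ∀ t ∈ Icc 0 T, HasDerivWithinAt p
      (-((Df t).comp (.inl ℝ E W)).adjoint (p t)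
        - ψ t • (InnerProductSpace.toDual ℝ E).symm ((Dℓ t).comp (.inr ℝ W E))) (Icc 0 T) t)
    {a : ℝ → W} (ha : a = fun t => ((Df t).comp (.inr ℝ E W)).adjoint (p t)
        + ψ t • (InnerProductSpace.toDual ℝ W).symm ((Dℓ t).comp (.inl ℝ W E)))
    (hac : ContinuousOn a (Icc 0 T)) {η : ℝ} (hη : 0 < η) :
    ∃ δ > 0, ∀ (κ : ℝ) (k : ℝ → W), 0 ≤ κ → κ ≤ δ → ContinuousOn k (Icc 0 T) →
      (∀ t ∈ Icc 0 T, ‖k t‖ ≤ κ) → ∃ y : ℝ → E, y 0 = x 0 ∧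
        (∀ t ∈ Icc 0 T, HasDerivWithinAt y (f (y t) (w t + k t) t) (Icc 0 T) t) ∧
        ∫ t in (0 : ℝ)..T, (ψ t * ℓ (w t + k t) (y t) t - ψ t * ℓ (w t) (x t) t)
          ≤ (∫ t in (0 : ℝ)..T, inner ℝ (a t) (k t)) + η * κ := by
  have hxc : ContinuousOn x (Icc 0 T) := fun t ht => (hx t ht).continuousWithinAt
  have hpc : ContinuousOn p (Icc 0 T) := fun t ht => (hp t ht).continuousWithinAt
  obtain ⟨C, hC1, hC⟩ := exists_perturbed_trajectory hT hf hxc hw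
  obtain ⟨M, hM⟩ := isCompact_Icc.exists_bound_of_continuousOn (hψ.norm.add hpc.norm)
  have hC0 : 0 < C := by linarith
  -- Both remainders together are at most `(|ψ| + ‖p‖) * η' * C * κ ≤ η * κ / T`, which integrates
  -- to `η * κ`.
  set η' := η / (C * (max M 1) * T) with hη'
  have hη'0 : 0 < η' := by positivity
  obtain ⟨δ₁, hδ₁, hexp₁⟩ := exists_uniform_expansion (g := fun (y : E × W) t => f y.1 y.2 t)
    hf.differentiable hf.continuousOn_fderiv (hxc.prodMk hw) hη'0
  obtain ⟨δ₂, hδ₂, hexp₂⟩ := exists_uniform_expansion (g := fun (y : W × E) t => ℓ y.1 y.2 t)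
    hℓ.differentiable hℓ.continuousOn_fderiv (hw.prodMk hxc) hη'0
  refine ⟨min 1 (min δ₁ δ₂) / C, by positivity, fun κ k hκ hκδ hk hkκ => ?_⟩
  rw [le_div_iff₀ hC0, mul_comm] at hκδ
  obtain ⟨e, he0, he⟩ := hC κ k hκ (hκδ.trans (min_le_left _ _)) hk hkκ
  have hec : ContinuousOn e (Icc 0 T) := fun t ht => (he t ht).2.continuousWithinAt
  have hkC : ∀ t ∈ Icc 0 T, ‖k t‖ ≤ C * κ := fun t ht =>
    (hkκ t ht).trans (le_mul_of_one_le_left hκ hC1)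
  have hyd : ∀ t ∈ Icc 0 T,
      HasDerivWithinAt (fun t => x t + e t) (f (x t + e t) (w t + k t) t) (Icc 0 T) t := by
    intro t ht
    exact ((hx t ht).add (he t ht).2).congr_deriv (add_sub_cancel _ _)
  refine ⟨fun t => x t + e t, by simp [he0], hyd, ?_⟩
  -- the derivative of `⟪p, e⟫` integrates to zero
  set d : ℝ → ℝ := fun t => inner ℝ (p t) (f (x t + e t) (w t + k t) t - f (x t) (w t) t)
    + inner ℝ (-((Df t).comp (.inl ℝ E W)).adjoint (p t)
        - ψ t • (InnerProductSpace.toDual ℝ E).symm ((Dℓ t).comp (.inr ℝ W E))) (e t) with hd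
  have hDfc : ContinuousOn Df (Icc 0 T) := hDf ▸ hf.fderiv_comp_continuousOn hxc hw
  have hDℓc : ContinuousOn Dℓ (Icc 0 T) := hDℓ ▸ hℓ.fderiv_comp_continuousOn hw hxc
  have hdc : ContinuousOn d (Icc 0 T) := by
    refine (hpc.inner ((hf.comp_continuousOn (hxc.add hec) (hw.add hk)).sub
      (hf.comp_continuousOn hxc hw))).add (ContinuousOn.inner ?_ hec)
    refine (ContinuousOn.neg ?_).sub (hψ.smul ?_)
    · exact ((ContinuousLinearMap.adjoint (𝕜 := ℝ)).continuous.comp_continuousOn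
        (hDfc.clm_comp continuousOn_const)).clm_apply hpc
    · exact (InnerProductSpace.toDual ℝ E).symm.continuous.comp_continuousOn
        (hDℓc.clm_comp continuousOn_const)
  -- The boundary terms vanish because `e 0 = 0` and `p T = 0`.
  have hdint : ∫ t in (0 : ℝ)..T, d t = 0 := by
    rw [intervalIntegral.integral_eq_sub_of_hasDerivAt_of_le hT.le (hpc.inner hec) (f' := d)
      (fun t ht => ((hp t (Ioo_subset_Icc_self ht)).inner ℝ
        (he t (Ioo_subset_Icc_self ht)).2).hasDerivAt (Icc_mem_nhds ht.1 ht.2))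
      (hdc.intervalIntegrable_of_Icc hT.le)]
    simp [hpT, he0]
  have hℓc : ContinuousOn (fun t => ψ t * ℓ (w t + k t) (x t + e t) t - ψ t * ℓ (w t) (x t) t)
      (Icc 0 T) :=
    (hψ.mul (hℓ.comp_continuousOn (hw.add hk) (hxc.add hec))).sub
      (hψ.mul (hℓ.comp_continuousOn hw hxc))
  have hakc : ContinuousOn (fun t => inner ℝ (a t) (k t)) (Icc 0 T) := hac.inner hk
  have hle : ∀ t ∈ Icc 0 T,
      ψ t * ℓ (w t + k t) (x t + e t) t - ψ t * ℓ (w t) (x t) t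
        ≤ inner ℝ (a t) (k t) - d t + η * κ / T := by
    intro t ht
    have r₁ := hexp₁ t ht (e t, k t) (by
      rw [Prod.norm_def]
      exact max_le ((he t ht).1.trans (hκδ.trans ((min_le_right _ _).trans (min_le_left _ _))))
        ((hkC t ht).trans (hκδ.trans ((min_le_right _ _).trans (min_le_left _ _)))))
    have r₂ := hexp₂ t ht (k t, e t) (by
      rw [Prod.norm_def]
      exact max_le ((hkC t ht).trans (hκδ.trans ((min_le_right _ _).trans (min_le_right _ _))))
        ((he t ht).1.trans (hκδ.trans ((min_le_right _ _).trans (min_le_right _ _)))))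
    have n₁ : ‖(e t, k t)‖ ≤ C * κ := by
      rw [Prod.norm_def]; exact max_le (he t ht).1 (hkC t ht)
    have n₂ : ‖(k t, e t)‖ ≤ C * κ := by
      rw [Prod.norm_def]; exact max_le (hkC t ht) (he t ht).1
    have eDf : fderiv ℝ (fun y : E × W => f y.1 y.2 t) (x t, w t) = Df t := by rw [hDf]
    have eDℓ : fderiv ℝ (fun y : W × E => ℓ y.1 y.2 t) (w t, x t) = Dℓ t := by rw [hDℓ]
    simp only [Prod.mk_add_mk, eDf, eDℓ] at r₁ r₂
    set rf := f (x t + e t) (w t + k t) t - f (x t) (w t) t - Df t (e t, k t) with hrf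
    set rl := ℓ (w t + k t) (x t + e t) t - ℓ (w t) (x t) t - Dℓ t (k t, e t) with hrl
    -- Subtracting `d` cancels every term linear in `e`; the adjoint equation is designed for this.
    have key : ψ t * ℓ (w t + k t) (x t + e t) t - ψ t * ℓ (w t) (x t) t
        = inner ℝ (a t) (k t) - d t + (ψ t * rl + inner ℝ (p t) rf) := by
      have efe : f (x t + e t) (w t + k t) t - f (x t) (w t) t = rf + Df t (e t, k t) := by
        rw [hrf]; abel
      simp only [hd, ha, efe, hrl, ContinuousLinearMap.apply_eq_comp_inl_add_comp_inr, inner_add_left,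
        inner_add_right, inner_sub_left, inner_neg_left, real_inner_smul_left,
        InnerProductSpace.toDual_symm_apply, ContinuousLinearMap.adjoint_inner_left]
      ring
    have hCκ : 0 ≤ C * κ := by positivity
    have b₁ : ψ t * rl ≤ |ψ t| * (η' * (C * κ)) := by
      refine (le_abs_self _).trans ?_
      rw [abs_mul]
      exact mul_le_mul_of_nonneg_left (r₂.trans (by gcongr)) (abs_nonneg _)
    have b₂ : inner ℝ (p t) rf ≤ ‖p t‖ * (η' * (C * κ)) :=
      (real_inner_le_norm _ _).trans
        (mul_le_mul_of_nonneg_left (r₁.trans (by gcongr)) (norm_nonneg _))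
    have b₃ : |ψ t| + ‖p t‖ ≤ max M 1 := by
      have := (le_abs_self _).trans (hM t ht)
      exact this.trans (le_max_left _ _)
    have b₄ : (|ψ t| + ‖p t‖) * (η' * (C * κ)) ≤ max M 1 * (η' * (C * κ)) :=
      mul_le_mul_of_nonneg_right b₃ (by positivity)
    have b₅ : max M 1 * (η' * (C * κ)) = η * κ / T := by
      rw [hη']; field_simp
    rw [key]
    linarith
  have hi : ∀ {g : ℝ → ℝ}, ContinuousOn g (Icc 0 T) → IntervalIntegrable g volume 0 T :=
    fun hg => hg.intervalIntegrable_of_Icc hT.le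
  refine (intervalIntegral.integral_mono_on hT.le (hi hℓc)
    (((hi hakc).sub (hi hdc)).add intervalIntegrable_const) hle).trans ?_
  rw [intervalIntegral.integral_add ((hi hakc).sub (hi hdc)) intervalIntegrable_const,
    intervalIntegral.integral_sub (hi hakc) (hi hdc), hdint, intervalIntegral.integral_const]
  simp only [sub_zero, smul_eq_mul]
  rw [mul_div_cancel₀ _ hT.ne']

end FirstVariation

/-! ### Square-integrable variations and a scalar first-order test -/

section Quadratic

variable {W : Type*} [NormedAddCommGroup W] [InnerProductSpace ℝ W] {α : Type*}
  [MeasurableSpace α] {μ : Measure α} {u h : α → W}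

lemma MeasureTheory.Integrable.inner_of_sq_norm (hu : AEStronglyMeasurable u μ) (hh : AEStronglyMeasurable h μ)
    (hu2 : Integrable (fun t => ‖u t‖ ^ 2) μ) (hh2 : Integrable (fun t => ‖h t‖ ^ 2) μ) :
    Integrable (fun t => inner ℝ (u t) (h t)) μ := by
  refine (hu2.add hh2).mono' (hu.inner hh) (Filter.Eventually.of_forall fun t => ?_)
  rw [Real.norm_eq_abs]
  refine (abs_real_inner_le_norm _ _).trans ?_
  simp only [Pi.add_apply]
  nlinarith [sq_nonneg (‖u t‖ - ‖h t‖), sq_nonneg (‖u t‖), sq_nonneg (‖h t‖)]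

lemma MeasureTheory.Integrable.sq_norm_add (hu : AEStronglyMeasurable u μ) (hh : AEStronglyMeasurable h μ)
    (hu2 : Integrable (fun t => ‖u t‖ ^ 2) μ) (hh2 : Integrable (fun t => ‖h t‖ ^ 2) μ) :
    Integrable (fun t => ‖u t + h t‖ ^ 2) μ := by
  simp only [norm_add_sq_real]
  exact (hu2.add ((Integrable.inner_of_sq_norm hu hh hu2 hh2).const_mul 2)).add hh2

end Quadratic

/-- If `-ε S + ε² Q + η ε B` is nonnegative for all small `ε > 0`, however small `η > 0`, then
`S` is nonpositive. -/
lemma nonpos_of_first_order {S Q B : ℝ} (hB : 0 ≤ B)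
    (H : ∀ η > 0, ∃ δ > 0, ∀ ε > 0, ε ≤ δ → 0 ≤ -(ε * S) + ε ^ 2 * Q + η * (ε * B)) : S ≤ 0 := by
  by_contra! hS
  -- With these `η` and `ε`, each error term is at most `ε * S / 4`, too little to offset `-ε * S`.
  obtain ⟨δ, hδ, h⟩ := H (S / (4 * (B + 1))) (by positivity)
  set ε := min δ (S / (4 * (|Q| + 1))) with hε
  have hε0 : 0 < ε := by positivity
  have h1 := h ε hε0 (min_le_left _ _)
  have h2 : ε * (|Q| + 1) ≤ S / 4 := by
    have := min_le_right δ (S / (4 * (|Q| + 1)))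
    rw [← hε, le_div_iff₀ (by positivity)] at this
    linarith
  have h3 : S / (4 * (B + 1)) * B ≤ S / 4 := by
    rw [div_mul_eq_mul_div, div_le_div_iff₀ (by positivity) (by positivity)]
    nlinarith
  have h4 : ε * Q ≤ S / 4 := by nlinarith [le_abs_self Q]
  have h5 : 0 ≤ ε * (-S + ε * Q + S / (4 * (B + 1)) * B) := by
    refine h1.trans_eq ?_
    ring
  have h6 := nonneg_of_mul_nonneg_right h5 hε0
  linarith

/-! ### Stationarity of the minimizing control -/

section Stationarity

variable {n N : ℕ} {T m c : ℝ} {φ : ℝ → ℝ}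
  {f : EuclideanSpace ℝ (Fin n) → EuclideanSpace ℝ (Fin N) → ℝ → EuclideanSpace ℝ (Fin n)}
  {ℓ : EuclideanSpace ℝ (Fin N) → EuclideanSpace ℝ (Fin n) → ℝ → ℝ}
  {x₀ : EuclideanSpace ℝ (Fin n)} {w₀ : EuclideanSpace ℝ (Fin N)}
  {v : ℝ → EuclideanSpace ℝ (Fin N)}
  {x : ℝ → EuclideanSpace ℝ (Fin n)} {w : ℝ → EuclideanSpace ℝ (Fin N)}

lemma IsAdmissible.continuousOn_state (h : IsAdmissible T f x₀ w₀ v x w) :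
    ContinuousOn x (Icc 0 T) :=
  fun t ht => (h.state_deriv t ht).continuousWithinAt

lemma IsAdmissible.intervalIntegrable (hT : 0 ≤ T) (h : IsAdmissible T f x₀ w₀ v x w) :
    IntervalIntegrable v volume 0 T :=
  (intervalIntegrable_iff_integrableOn_Icc_of_le hT).2 h.integrableOn

lemma IsAdmissible.continuousOn_weight (hT : 0 ≤ T) (h : IsAdmissible T f x₀ w₀ v x w) :
    ContinuousOn w (Icc 0 T) := by
  have := intervalIntegral.continuousOn_primitive_interval' (h.intervalIntegrable hT) left_mem_uIcc
  rw [uIcc_of_le hT] at this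
  exact (continuousOn_const.add this).congr h.weight_eq

/-- The integrand of the functional `G`. -/
noncomputable def costDensity (m c : ℝ) (φ : ℝ → ℝ)
    (ℓ : EuclideanSpace ℝ (Fin N) → EuclideanSpace ℝ (Fin n) → ℝ → ℝ)
    (v : ℝ → EuclideanSpace ℝ (Fin N))
    (x : ℝ → EuclideanSpace ℝ (Fin n)) (w : ℝ → EuclideanSpace ℝ (Fin N)) (t : ℝ) : ℝ :=
  (m * c / 2 * ‖v t‖ ^ 2 + c * ℓ (w t) (x t) t) * φ t

lemma costDensity_nonneg (hm : 0 < m) (hc : 0 < c) (hφ_pos : ∀ t ∈ Icc 0 T, 0 < φ t)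
    (hℓ_nonneg : ∀ t ∈ Icc 0 T, ∀ u ξ, 0 ≤ ℓ u ξ t) :
    ∀ᵐ t ∂volume.restrict (Icc 0 T), 0 ≤ costDensity m c φ ℓ v x w t := by
  refine (ae_restrict_iff' measurableSet_Icc).2 (Filter.Eventually.of_forall fun t ht => ?_)
  have := hφ_pos t ht
  have := hℓ_nonneg t ht (w t) (x t)
  simp only [costDensity]
  positivity

lemma integrableOn_costDensity (hφ : ContinuousOn φ (Icc 0 T)) (hℓ : IsC1InState T ℓ)
    (hv : IntegrableOn (fun t => ‖v t‖ ^ 2) (Icc 0 T))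
    (hx : ContinuousOn x (Icc 0 T)) (hw : ContinuousOn w (Icc 0 T)) :
    IntegrableOn (costDensity m c φ ℓ v x w) (Icc 0 T) :=
  IntegrableOn.mul_continuousOn ((hv.const_mul (m * c / 2)).add
    ((hℓ.comp_continuousOn hw hx).integrableOn_Icc.const_mul c)) hφ isCompact_Icc

/-- The density is nonnegative, so finite cost means integrable. Dividing by the positive continuous
`φ` and removing the continuous running cost leaves a multiple of `‖v‖ ^ 2`. -/
lemma IsAdmissible.integrableOn_sq_norm (hT : 0 ≤ T) (hm : 0 < m) (hc : 0 < c)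
    (hφ : ContinuousOn φ (Icc 0 T)) (hφ_pos : ∀ t ∈ Icc 0 T, 0 < φ t) (hℓ : IsC1InState T ℓ)
    (hℓ_nonneg : ∀ t ∈ Icc 0 T, ∀ u ξ, 0 ≤ ℓ u ξ t)
    (h : IsAdmissible T f x₀ w₀ v x w) (hG : costG T m c φ ℓ v x w ≠ ⊤) :
    IntegrableOn (fun t => ‖v t‖ ^ 2) (Icc 0 T) := by
  have hℓc := hℓ.comp_continuousOn (h.continuousOn_weight hT) h.continuousOn_state
  have hmeas : AEStronglyMeasurable (costDensity m c φ ℓ v x w) (volume.restrict (Icc 0 T)) :=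
    (((h.integrableOn.aestronglyMeasurable.norm.pow 2).const_mul (m * c / 2)).add
      ((hℓc.aestronglyMeasurable measurableSet_Icc).const_mul c)).mul
      (hφ.aestronglyMeasurable measurableSet_Icc)
  have hint : IntegrableOn (costDensity m c φ ℓ v x w) (Icc 0 T) :=
    (lintegral_ofReal_ne_top_iff_integrable hmeas
      (costDensity_nonneg hm hc hφ_pos hℓ_nonneg)).1 hG
  have hφi : ContinuousOn (fun t => (φ t)⁻¹) (Icc 0 T) := hφ.inv₀ fun t ht => (hφ_pos t ht).ne'
  refine IntegrableOn.congr_fun (((hint.mul_continuousOn hφi isCompact_Icc).sub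
    (hℓc.integrableOn_Icc.const_mul c)).const_mul (2 / (m * c))) (fun t ht => ?_)
    measurableSet_Icc
  have := (hφ_pos t ht).ne'
  simp only [costDensity, Pi.sub_apply]
  field_simp
  ring

/-- The stationarity condition `m c φ v + p_w = 0`. -/
theorem IsMinimizer.ae_stationary (hT : 0 < T) (hm : 0 < m) (hc : 0 < c)
    (hφ : ContinuousOn φ (Icc 0 T)) (hφ_pos : ∀ t ∈ Icc 0 T, 0 < φ t)
    (hℓ : IsC1InState T ℓ) (hℓ_nonneg : ∀ t ∈ Icc 0 T, ∀ u ξ, 0 ≤ ℓ u ξ t)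
    (hmin : IsMinimizer T m c φ f ℓ x₀ w₀ v x w)
    {a : ℝ → EuclideanSpace ℝ (Fin N)} (hac : ContinuousOn a (Icc 0 T))
    (hvar : ∀ η > 0, ∃ δ > 0, ∀ (κ : ℝ) (k : ℝ → EuclideanSpace ℝ (Fin N)), 0 ≤ κ → κ ≤ δ →
      ContinuousOn k (Icc 0 T) → (∀ t ∈ Icc 0 T, ‖k t‖ ≤ κ) →
      ∃ y : ℝ → EuclideanSpace ℝ (Fin n), y 0 = x 0 ∧
        (∀ t ∈ Icc 0 T, HasDerivWithinAt y (f (y t) (w t + k t) t) (Icc 0 T) t) ∧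
        ∫ t in (0 : ℝ)..T, (c * φ t * ℓ (w t + k t) (y t) t - c * φ t * ℓ (w t) (x t) t)
          ≤ (∫ t in (0 : ℝ)..T, inner ℝ (a t) (k t)) + η * κ) :
    ∀ᵐ t ∂volume.restrict (Icc 0 T),
      (m * c * φ t) • v t + ((∫ s in (0 : ℝ)..T, a s) - ∫ s in (0 : ℝ)..t, a s) = 0 := by
  have hadm := hmin.admissible
  have hxc := hadm.continuousOn_state
  have hwc := hadm.continuousOn_weight hT.le
  have hvm := hadm.integrableOn.aestronglyMeasurable
  have hv2 := hadm.integrableOn_sq_norm hT.le hm hc hφ hφ_pos hℓ hℓ_nonneg hmin.cost_ne_top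
  have hai : IntervalIntegrable a volume 0 T := hac.intervalIntegrable_of_Icc hT.le
  set q : ℝ → EuclideanSpace ℝ (Fin N) :=
    fun t => (∫ s in (0 : ℝ)..T, a s) - ∫ s in (0 : ℝ)..t, a s with hq
  have hqc : ContinuousOn q (Icc 0 T) := by
    have := intervalIntegral.continuousOn_primitive_interval' hai left_mem_uIcc
    rw [uIcc_of_le hT.le] at this
    exact continuousOn_const.sub this
  set ψ : ℝ → ℝ := fun t => m * c * φ t with hψ
  have hψc : ContinuousOn ψ (Icc 0 T) := continuousOn_const.mul hφ
  set h : ℝ → EuclideanSpace ℝ (Fin N) := fun t => ψ t • v t + q t with hh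
  have hψv : IntegrableOn (fun t => ψ t • v t) (Icc 0 T) :=
    hadm.integrableOn.continuousOn_smul hψc isCompact_Icc
  have hhI : IntegrableOn h (Icc 0 T) := hψv.add hqc.integrableOn_Icc
  have hhi : IntervalIntegrable h volume 0 T :=
    (intervalIntegrable_iff_integrableOn_Icc_of_le hT.le).2 hhI
  have hh2 : IntegrableOn (fun t => ‖h t‖ ^ 2) (Icc 0 T) := by
    refine Integrable.sq_norm_add hψv.aestronglyMeasurable
      (hqc.aestronglyMeasurable measurableSet_Icc) ?_ (hqc.norm.pow 2).integrableOn_Icc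
    refine (IntegrableOn.continuousOn_mul (hψc.pow 2) hv2 isCompact_Icc).congr_fun
      (fun t _ => ?_) measurableSet_Icc
    simp [norm_smul, mul_pow]
  set S := ∫ t in Icc 0 T, ‖h t‖ ^ 2 with hS
  have hS0 : S ≤ 0 := by
    refine nonpos_of_first_order (Q := ∫ t in Icc 0 T, ψ t / 2 * ‖h t‖ ^ 2)
      (B := ∫ t in Icc 0 T, ‖h t‖) (integral_nonneg fun t => norm_nonneg _) fun η hη => ?_
    set B := ∫ t in Icc 0 T, ‖h t‖ with hB
    have hB0 : 0 ≤ B := integral_nonneg fun t => norm_nonneg _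
    obtain ⟨δ, hδ, H⟩ := hvar η hη
    -- The weight perturbation is bounded by `ε` times the `L¹` norm `B` of `h`, so this keeps it
    -- below `δ` even if `h` is unbounded.
    refine ⟨δ / (B + 1), by positivity, fun ε hε hεδ => ?_⟩
    rw [le_div_iff₀ (by positivity)] at hεδ
    set k : ℝ → EuclideanSpace ℝ (Fin N) := fun t => ∫ s in (0 : ℝ)..t, (-ε) • h s with hk
    have hki : IntervalIntegrable (fun t => (-ε) • h t) volume 0 T := hhi.smul (-ε)
    have hkc : ContinuousOn k (Icc 0 T) := by
      have := intervalIntegral.continuousOn_primitive_interval' hki left_mem_uIcc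
      rwa [uIcc_of_le hT.le] at this
    have hkκ : ∀ t ∈ Icc 0 T, ‖k t‖ ≤ ε * B := by
      intro t ht
      have e1 : k t = (-ε) • ∫ s in (0 : ℝ)..t, h s := intervalIntegral.integral_smul _ _
      rw [e1, norm_smul, norm_neg, Real.norm_of_nonneg hε.le]
      refine mul_le_mul_of_nonneg_left ?_ hε.le
      refine (intervalIntegral.norm_integral_le_integral_norm ht.1).trans ?_
      rw [intervalIntegral.integral_of_le ht.1]
      exact setIntegral_mono_set hhI.norm (Filter.Eventually.of_forall fun t => norm_nonneg _)
        (Filter.Eventually.of_forall fun s hs => ⟨hs.1.le, hs.2.trans ht.2⟩)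
    obtain ⟨y, hy0, hy, hyle⟩ := H (ε * B) k (by positivity) (by nlinarith) hkc hkκ
    have hyc : ContinuousOn y (Icc 0 T) := fun t ht => (hy t ht).continuousWithinAt
    have hadm' : IsAdmissible T f x₀ w₀ (fun t => v t + (-ε) • h t) y (fun t => w t + k t) := by
      refine ⟨hadm.integrableOn.add (hhI.smul (-ε)), fun t ht => ?_, hy0.trans hadm.state_init, hy⟩
      have hsub : uIcc 0 t ⊆ uIcc 0 T :=
        uIcc_subset_uIcc left_mem_uIcc (by rwa [uIcc_of_le hT.le])
      rw [intervalIntegral.integral_add ((hadm.intervalIntegrable hT.le).mono_set hsub)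
        (hki.mono_set hsub), hadm.weight_eq t ht, add_assoc]
    have hεh2 : IntegrableOn (fun t => ‖(-ε) • h t‖ ^ 2) (Icc 0 T) := by
      simp only [norm_smul, mul_pow]
      exact hh2.const_mul _
    have hv'2 : IntegrableOn (fun t => ‖v t + (-ε) • h t‖ ^ 2) (Icc 0 T) :=
      Integrable.sq_norm_add hvm (hhI.smul (-ε)).aestronglyMeasurable hv2 hεh2
    have hF := integrableOn_costDensity (m := m) (c := c) hφ hℓ hv2 hxc hwc
    have hF' := integrableOn_costDensity (m := m) (c := c) (w := fun t => w t + k t) hφ hℓ hv'2 hyc (hwc.add hkc)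
    have hcost := hmin.cost_le _ _ _ hadm'
    have hle : ∫ t in Icc 0 T, costDensity m c φ ℓ v x w t
        ≤ ∫ t in Icc 0 T, costDensity m c φ ℓ (fun t => v t + (-ε) • h t) y
          (fun t => w t + k t) t := by
      have p1 := costDensity_nonneg (v := v) (x := x) (w := w) hm hc hφ_pos hℓ_nonneg
      have p2 := costDensity_nonneg (v := fun t => v t + (-ε) • h t) (x := y)
        (w := fun t => w t + k t) hm hc hφ_pos hℓ_nonneg
      rw [← ENNReal.ofReal_le_ofReal_iff (integral_nonneg_of_ae p2),
        ofReal_integral_eq_lintegral_ofReal hF p1, ofReal_integral_eq_lintegral_ofReal hF' p2]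
      exact hcost
    have hvh : IntegrableOn (fun t => inner ℝ (v t) (h t)) (Icc 0 T) :=
      Integrable.inner_of_sq_norm hvm hhI.aestronglyMeasurable hv2 hh2
    have hψvh : IntegrableOn (fun t => ψ t * inner ℝ (v t) (h t)) (Icc 0 T) :=
      IntegrableOn.continuousOn_mul hψc hvh isCompact_Icc
    have hqh : IntegrableOn (fun t => inner ℝ (q t) (h t)) (Icc 0 T) :=
      Integrable.inner_of_sq_norm (hqc.aestronglyMeasurable measurableSet_Icc)
        hhI.aestronglyMeasurable (hqc.norm.pow 2).integrableOn_Icc hh2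
    have hψh2 : IntegrableOn (fun t => ψ t / 2 * ‖h t‖ ^ 2) (Icc 0 T) :=
      IntegrableOn.continuousOn_mul (hψc.div_const 2) hh2 isCompact_Icc
    have hDc : ContinuousOn
        (fun t => c * φ t * ℓ (w t + k t) (y t) t - c * φ t * ℓ (w t) (x t) t) (Icc 0 T) :=
      ((continuousOn_const.mul hφ).mul (hℓ.comp_continuousOn (hwc.add hkc) hyc)).sub
        ((continuousOn_const.mul hφ).mul (hℓ.comp_continuousOn hwc hxc))
    -- The kinetic term is quadratic in the control and expands exactly; only the running cost needs
    -- the first variation.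
    have hdiff : (∫ t in Icc 0 T, costDensity m c φ ℓ (fun t => v t + (-ε) • h t) y
          (fun t => w t + k t) t) - ∫ t in Icc 0 T, costDensity m c φ ℓ v x w t
        = (-ε) * (∫ t in Icc 0 T, ψ t * inner ℝ (v t) (h t))
          + ε ^ 2 * (∫ t in Icc 0 T, ψ t / 2 * ‖h t‖ ^ 2)
          + ∫ t in Icc 0 T, (c * φ t * ℓ (w t + k t) (y t) t - c * φ t * ℓ (w t) (x t) t) := by
      have hsum : IntegrableOn (fun t => (-ε) * (ψ t * inner ℝ (v t) (h t))
          + ε ^ 2 * (ψ t / 2 * ‖h t‖ ^ 2)) (Icc 0 T) :=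
        (hψvh.const_mul _).add (hψh2.const_mul _)
      rw [← integral_sub hF' hF, ← integral_const_mul, ← integral_const_mul,
        ← integral_add (hψvh.const_mul _) (hψh2.const_mul _),
        ← integral_add hsum hDc.integrableOn_Icc]
      refine integral_congr_ae (Filter.Eventually.of_forall fun t => ?_)
      simp only [costDensity, norm_add_sq_real, real_inner_smul_right, norm_smul, norm_neg,
        Real.norm_eq_abs, mul_pow, sq_abs, hψ]
      ring
    have hparts : ∫ t in (0 : ℝ)..T, inner ℝ (a t) (k t)
        = (-ε) * ∫ t in Icc 0 T, inner ℝ (q t) (h t) := by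
      rw [hk, intervalIntegral_inner_primitive hai hki, intervalIntegral.integral_of_le hT.le,
        ← integral_Icc_eq_integral_Ioc, ← integral_const_mul]
      simp only [real_inner_smul_right, hq]
    -- The kinetic part and the part integrated by parts add up to `∫ ‖h‖²`, so minimality reads `0
    -- ≤ -ε S + ε² Q + η ε B`.
    have hSsplit : S = (∫ t in Icc 0 T, ψ t * inner ℝ (v t) (h t))
        + ∫ t in Icc 0 T, inner ℝ (q t) (h t) := by
      rw [hS, ← integral_add hψvh hqh]
      refine integral_congr_ae (Filter.Eventually.of_forall fun t => ?_)
      simp only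
      rw [← real_inner_self_eq_norm_sq, ← real_inner_smul_left, ← inner_add_left]
    rw [hparts, intervalIntegral.integral_of_le hT.le, ← integral_Icc_eq_integral_Ioc] at hyle
    rw [hSsplit]
    linarith
  have hzero : S = 0 := le_antisymm hS0 (integral_nonneg fun t => by positivity)
  have := (integral_eq_zero_iff_of_nonneg (fun t => by positivity) hh2).1 hzero
  filter_upwards [this] with t ht
  simpa using ht

end Stationarity

/-! ### Partial gradients of the Hamiltonian -/

section Gradients

variable {V E : Type*} [NormedAddCommGroup V] [InnerProductSpace ℝ V] [CompleteSpace V]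
  [NormedAddCommGroup E] [InnerProductSpace ℝ E] [CompleteSpace E]

lemma gradient_const_add_inner (A : ℝ) (b p : V) :
    gradient (fun p => A + inner ℝ p b) p = b := by
  refine HasGradientAt.gradient (hasGradientAt_iff_hasFDerivAt.2 ?_)
  refine (((InnerProductSpace.toDual ℝ V b).hasFDerivAt (x := p)).const_add A).congr_of_eventuallyEq
    (Filter.Eventually.of_forall fun y => ?_)
  simp [real_inner_comm]

lemma gradient_mul_norm_sq_add (A B : ℝ) (q : V) :
    gradient (fun q : V => A * ‖q‖ ^ 2 + B) q = (2 * A) • q := by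
  refine HasGradientAt.gradient (hasGradientAt_iff_hasFDerivAt.2 ?_)
  refine ((((hasStrictFDerivAt_norm_sq q).hasFDerivAt).const_mul A).add_const B).congr_fderiv ?_
  ext y
  simp
  ring

/-- Serves both `H_ξ` and `H_u`; `A` absorbs the term in `q`. -/
lemma gradient_mul_add_inner {L : V → ℝ} {F : V → E} {L' : V →L[ℝ] ℝ} {F' : V →L[ℝ] E} {y : V}
    (hL : HasFDerivAt L L' y) (hF : HasFDerivAt F F' y) (A c φ : ℝ) (p : E) :
    gradient (fun y => A + c * L y * φ + inner ℝ p (F y)) y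
      = F'.adjoint p + (c * φ) • (InnerProductSpace.toDual ℝ V).symm L' := by
  refine HasGradientAt.gradient (hasGradientAt_iff_hasFDerivAt.2 ?_)
  refine ((((hL.const_mul c).mul_const φ).const_add A).add
    ((innerSL ℝ p).hasFDerivAt.comp y hF)).congr_fderiv ?_
  ext a
  simp [ContinuousLinearMap.adjoint_inner_left]
  ring

end Gradients

section Partials

variable {A B F : Type*} [NormedAddCommGroup A] [NormedSpace ℝ A] [NormedAddCommGroup B]
  [NormedSpace ℝ B] [NormedAddCommGroup F] [NormedSpace ℝ F] {T t : ℝ} {g : A → B → ℝ → F}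

lemma IsC1InState.hasFDerivAt_left (hg : IsC1InState T g) (ht : t ∈ Icc 0 T) (a : A) (b : B) :
    HasFDerivAt (fun a => g a b t)
      ((fderiv ℝ (fun y : A × B => g y.1 y.2 t) (a, b)).comp (.inl ℝ A B)) a :=
  HasFDerivAt.comp (g := fun y : A × B => g y.1 y.2 t) (f := fun a => (a, b)) a
    (hg.differentiable t ht (a, b)).hasFDerivAt (hasFDerivAt_prodMk_left a b)

lemma IsC1InState.hasFDerivAt_right (hg : IsC1InState T g) (ht : t ∈ Icc 0 T) (a : A) (b : B) :
    HasFDerivAt (fun b => g a b t)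
      ((fderiv ℝ (fun y : A × B => g y.1 y.2 t) (a, b)).comp (.inr ℝ A B)) b :=
  HasFDerivAt.comp (g := fun y : A × B => g y.1 y.2 t) (f := fun b => (a, b)) b
    (hg.differentiable t ht (a, b)).hasFDerivAt (hasFDerivAt_prodMk_right a b)

end Partials

/-- Covers the endpoints with `g` continuous only on `[0,T]`: the primitive is a Picard iterate for
a field independent of the state. -/
lemma hasDerivWithinAt_primitive_Icc {E : Type*} [NormedAddCommGroup E] [NormedSpace ℝ E]
    [CompleteSpace E] {T t : ℝ} {g : ℝ → E} (hg : ContinuousOn g (Icc 0 T)) (ht : t ∈ Icc 0 T) :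
    HasDerivWithinAt (fun t => ∫ s in (0 : ℝ)..t, g s) (g t) (Icc 0 T) t := by
  have := ODE.hasDerivWithinAt_picard_Icc (f := fun t (_ : E) => g t) (α := fun _ => (0 : E))
    (u := univ) (left_mem_Icc.2 (ht.1.trans ht.2))
    (hg.comp continuousOn_fst fun z hz => hz.1) continuousOn_const (fun _ _ => mem_univ _) 0 ht
  exact this.congr (fun s _ => by simp) (by simp)

/-! ### Assembly of Hamilton's equations -/

theorem mainTheorem1 {n N : ℕ} (T m c : ℝ) (hT : 0 < T) (hm : 0 < m) (hc : 0 < c)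
    (φ : ℝ → ℝ) (hφ : ContDiffOn ℝ ∞ φ (Icc 0 T)) (hφ_pos : ∀ t ∈ Icc 0 T, 0 < φ t)
    (f : EuclideanSpace ℝ (Fin n) → EuclideanSpace ℝ (Fin N) → ℝ → EuclideanSpace ℝ (Fin n))
    (hf : IsC1InState T f)
    (ℓ : EuclideanSpace ℝ (Fin N) → EuclideanSpace ℝ (Fin n) → ℝ → ℝ)
    (hℓ : IsC1InState T ℓ) (hℓ_nonneg : ∀ t ∈ Icc 0 T, ∀ u ξ, 0 ≤ ℓ u ξ t)
    (x₀ : EuclideanSpace ℝ (Fin n)) (w₀ : EuclideanSpace ℝ (Fin N))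
    (v : ℝ → EuclideanSpace ℝ (Fin N))
    (x : ℝ → EuclideanSpace ℝ (Fin n)) (w : ℝ → EuclideanSpace ℝ (Fin N))
    (hmin : IsMinimizer T m c φ f ℓ x₀ w₀ v x w) :
    ∃ (px : ℝ → EuclideanSpace ℝ (Fin n)) (pw : ℝ → EuclideanSpace ℝ (Fin N)),
      SolvesCanonicalEquations T (hamiltonian m c φ f ℓ) x w px pw ∧
      (∀ t ∈ Icc 0 T,
        HasDerivWithinAt x (f (x t) (w t) t) (Icc 0 T) t ∧
        HasDerivWithinAt w (-((m * c * φ t)⁻¹ • pw t)) (Icc 0 T) t ∧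
        HasDerivWithinAt px
          (-(ContinuousLinearMap.adjoint (fderiv ℝ (fun ξ => f ξ (w t) t) (x t)) (px t))
            - (c * φ t) • gradient (fun ξ => ℓ (w t) ξ t) (x t)) (Icc 0 T) t ∧
        HasDerivWithinAt pw
          (-(ContinuousLinearMap.adjoint (fderiv ℝ (fun u => f (x t) u t) (w t)) (px t))
            - (c * φ t) • gradient (fun u => ℓ u (x t) t) (w t)) (Icc 0 T) t) ∧
      x 0 = x₀ ∧ w 0 = w₀ ∧ px T = 0 ∧ pw T = 0 := by
  have hadm := hmin.admissible
  have hxc := hadm.continuousOn_state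
  have hwc := hadm.continuousOn_weight hT.le
  have hφc := hφ.continuousOn
  have hψc : ContinuousOn (fun t => c * φ t) (Icc 0 T) := continuousOn_const.mul hφc
  obtain ⟨Df, hDf⟩ : ∃ D, D = fun t => fderiv ℝ (fun y : EuclideanSpace ℝ (Fin n) ×
    EuclideanSpace ℝ (Fin N) => f y.1 y.2 t) (x t, w t) := ⟨_, rfl⟩
  obtain ⟨Dℓ, hDℓ⟩ : ∃ D, D = fun t => fderiv ℝ (fun y : EuclideanSpace ℝ (Fin N) ×
    EuclideanSpace ℝ (Fin n) => ℓ y.1 y.2 t) (w t, x t) := ⟨_, rfl⟩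
  have hDfc : ContinuousOn Df (Icc 0 T) := hDf ▸ hf.fderiv_comp_continuousOn hxc hwc
  have hDℓc : ContinuousOn Dℓ (Icc 0 T) := hDℓ ▸ hℓ.fderiv_comp_continuousOn hwc hxc
  obtain ⟨px, hpxT, hpx⟩ := exists_solution_linear_terminal hT
    (A := fun t => ((Df t).comp (.inl ℝ _ _)).adjoint)
    (b := fun t => (c * φ t) • (InnerProductSpace.toDual ℝ _).symm ((Dℓ t).comp (.inr ℝ _ _)))
    ((ContinuousLinearMap.adjoint (𝕜 := ℝ)).continuous.comp_continuousOn
      (hDfc.clm_comp continuousOn_const))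
    (hψc.smul ((InnerProductSpace.toDual ℝ _).symm.continuous.comp_continuousOn
      (hDℓc.clm_comp continuousOn_const)))
  have hpxc : ContinuousOn px (Icc 0 T) := fun t ht => (hpx t ht).continuousWithinAt
  obtain ⟨a, ha⟩ : ∃ a, a = fun t => ((Df t).comp (.inr ℝ _ _)).adjoint (px t)
    + (c * φ t) • (InnerProductSpace.toDual ℝ _).symm ((Dℓ t).comp (.inl ℝ _ _)) := ⟨_, rfl⟩
  have hac : ContinuousOn a (Icc 0 T) := by
    rw [ha]
    exact (((ContinuousLinearMap.adjoint (𝕜 := ℝ)).continuous.comp_continuousOn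
      (hDfc.clm_comp continuousOn_const)).clm_apply hpxc).add
      (hψc.smul ((InnerProductSpace.toDual ℝ _).symm.continuous.comp_continuousOn
        (hDℓc.clm_comp continuousOn_const)))
  have hstat := hmin.ae_stationary hT hm hc hφc hφ_pos hℓ hℓ_nonneg hac fun η hη =>
    exists_variation_cost_le hT hf hℓ hψc hwc hadm.state_deriv hDf hDℓ hpxT hpx ha hac hη
  obtain ⟨pw, hpw⟩ : ∃ q, q = fun t => (∫ s in (0 : ℝ)..T, a s) - ∫ s in (0 : ℝ)..t, a s :=
    ⟨_, rfl⟩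
  have hpwd : ∀ t ∈ Icc 0 T, HasDerivWithinAt pw (-a t) (Icc 0 T) t := fun t ht =>
    hpw ▸ (hasDerivWithinAt_primitive_Icc hac ht).const_sub _
  have hpwc : ContinuousOn pw (Icc 0 T) := fun t ht => (hpwd t ht).continuousWithinAt
  have hv : ∀ᵐ t ∂volume.restrict (Icc 0 T), v t = -((m * c * φ t)⁻¹ • pw t) := by
    filter_upwards [hstat, ae_restrict_mem measurableSet_Icc] with t h ht
    have h0 : m * c * φ t ≠ 0 := by have := hφ_pos t ht; positivity
    have h1 : (m * c * φ t) • v t = -pw t := by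
      rw [hpw]; exact eq_neg_of_add_eq_zero_left h
    rw [← smul_neg, ← h1, inv_smul_smul₀ h0]
  have hrc : ContinuousOn (fun t => -((m * c * φ t)⁻¹ • pw t)) (Icc 0 T) :=
    (((continuousOn_const.mul hφc).inv₀ fun t ht =>
      mul_ne_zero (mul_pos hm hc).ne' (hφ_pos t ht).ne').smul hpwc).neg
  -- Only integrals of `v` enter `w`, so the a.e. identity suffices; the new integrand is
  -- continuous, hence `w` is differentiable everywhere on `[0,T]`.
  have hw : ∀ t ∈ Icc 0 T, w t = w₀ + ∫ s in (0 : ℝ)..t, -((m * c * φ s)⁻¹ • pw s) := by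
    intro t ht
    rw [hadm.weight_eq t ht]
    congr 1
    refine intervalIntegral.integral_congr_ae ?_
    filter_upwards [(ae_restrict_iff' measurableSet_Icc).1 hv] with s hs hs'
    rw [uIoc_of_le ht.1] at hs'
    exact hs ⟨hs'.1.le, hs'.2.trans ht.2⟩
  have hwd : ∀ t ∈ Icc 0 T, HasDerivWithinAt w (-((m * c * φ t)⁻¹ • pw t)) (Icc 0 T) t :=
    fun t ht => ((hasDerivWithinAt_primitive_Icc hrc ht).const_add w₀).congr hw (hw t ht)
  have hfξ : ∀ t ∈ Icc 0 T, HasFDerivAt (fun ξ => f ξ (w t) t) ((Df t).comp (.inl ℝ _ _)) (x t) :=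
    fun t ht => hDf ▸ hf.hasFDerivAt_left ht _ _
  have hfu : ∀ t ∈ Icc 0 T, HasFDerivAt (fun u => f (x t) u t) ((Df t).comp (.inr ℝ _ _)) (w t) :=
    fun t ht => hDf ▸ hf.hasFDerivAt_right ht _ _
  have hℓu : ∀ t ∈ Icc 0 T, HasFDerivAt (fun u => ℓ u (x t) t) ((Dℓ t).comp (.inl ℝ _ _)) (w t) :=
    fun t ht => hDℓ ▸ hℓ.hasFDerivAt_left ht _ _
  have hℓξ : ∀ t ∈ Icc 0 T, HasFDerivAt (fun ξ => ℓ (w t) ξ t) ((Dℓ t).comp (.inr ℝ _ _)) (x t) :=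
    fun t ht => hDℓ ▸ hℓ.hasFDerivAt_right ht _ _
  refine ⟨px, pw, ⟨fun t ht => ?_, fun t ht => ?_, fun t ht => ?_, fun t ht => ?_⟩,
    fun t ht => ⟨hadm.state_deriv t ht, hwd t ht, ?_, ?_⟩, hadm.state_init, ?_, hpxT, ?_⟩
  · refine (hadm.state_deriv t ht).congr_deriv ?_
    simp only [hamiltonian]
    rw [gradient_const_add_inner]
  · refine (hwd t ht).congr_deriv ?_
    have e : (fun q => hamiltonian m c φ f ℓ (x t) (w t) (px t) q t) =
        fun q => -(1 / φ t) / (2 * m * c) * ‖q‖ ^ 2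
          + (c * ℓ (w t) (x t) t * φ t + inner ℝ (px t) (f (x t) (w t) t)) := by
      funext q
      simp only [hamiltonian]
      ring
    rw [e, gradient_mul_norm_sq_add, ← neg_smul]
    congr 1
    have := (hφ_pos t ht).ne'
    field_simp
  · refine (hpx t ht).congr_deriv ?_
    simp only [hamiltonian]
    rw [gradient_mul_add_inner (hℓξ t ht) (hfξ t ht), neg_add, sub_eq_add_neg]
  · refine (hpwd t ht).congr_deriv ?_
    simp only [hamiltonian]
    rw [gradient_mul_add_inner (hℓu t ht) (hfu t ht), ha]
  · rw [gradient, (hfξ t ht).fderiv, (hℓξ t ht).fderiv]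
    exact hpx t ht
  · rw [gradient, (hfu t ht).fderiv, (hℓu t ht).fderiv]
    refine (hpwd t ht).congr_deriv ?_
    rw [ha, neg_add, sub_eq_add_neg]
  · simpa using hadm.weight_eq 0 (left_mem_Icc.2 hT.le)
  · simp [hpw]
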